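/- **Language.** Fix a countably infinite set $\mathsf V$ of variables and, for each $n\in\omega$, a countable set $\mathsf{Pred}(n)$ of $n$-ary predicate symbols. The set $\Phi$ of formulas is built from $\top$, $\bot$ and atomic formulas $P(x_1,\dots,x_n)$ by $\land,\neg,\Box$ and $\forall x$; $\lor,\supset,\equiv$ are the usual abbreviations. $[y/x]\phi$ denotes capture-avoiding substitution of the variable $y$ for the free occurrences of $x$, and $\mathsf{Sub}$ is the set of all maps $s:\Phi\to\Phi$ that uniformly (and without capture) substitute formulas for predicate symbols. **Logics.** A *predicate modal logic* is a set $L\subseteq\Phi$ that contains all classical predicate tautologies, is closed under modus ponens, uniform substitution and generalization ($\phi\in L\Rightarrow\forall x\phi\in L$), and satisfies $\phi\equiv\psi\in L\Rightarrow\Box\phi\equiv\Box\psi\in L$. It satisfies $\mathrm{MT}$ if $\Box(\phi\land\psi)\supset\Box\phi\land\Box\psi\in L$ for all $\phi,\psi$. An *$\omega$-pair* $(\alpha,(\beta_i)_{i\in\omega})$ consists of closed formulas; $L$ *admits* it if for all $s\in\mathsf{Sub}$: $s(\alpha\supset\beta_i)\in L$ for every $i$, and for every formula $\phi$, $\phi\supset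 s(\alpha)\in L$ whenever $\phi\supset s(\beta_i)\in L$ for all $i$. **Frames.** A *neighborhood frame* $Z=\langle C,\mathcal N\rangle$ is a non-empty set $C$ with a map $\mathcal N:C\to\mathcal P(\mathcal P(C))$. Given a non-empty domain $\mathcal D$, relations $P^{\mathcal I}(c)\subseteq\mathcal D^n$ for $c\in C$, $P\in\mathsf{Pred}(n)$, and an assignment $\mathcal A:\mathsf V\to\mathcal D$, the value $v_{\mathcal I,\mathcal A}(\phi)\subseteq C$ is defined by $v(\top)=C$, $v(\bot)=\emptyset$, $v(P(\vec x))=\{c\mid \mathcal A(\vec x)\in P^{\mathcal I}(c)\}$, $v(\phi\land\psi)=v(\phi)\cap v(\psi)$, $v(\neg\phi)=C\setminus v(\phi)$, $v_{\mathcal I,\mathcal A}(\forall x\phi)=\bigcap_{d\in\mathcal D}v_{\mathcal I,[d/x]\mathcal A}(\phi)$ and $v(\Box\phi)=\{c\mid v(\phi)\in\mathcal N(c)\}$. $Z\models\phi$ means $v_{\mathcal I,\mathcal A}(\phi)=C$ for all $\mathcal D,\mathcal I,\mathcal A$. Let $\mathscr C(L)$ be the class of neighborhood frames validating every formula of $L$.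 $L$ is *sound* (respectively *complete*) with respect to a class $\mathcal C$ of frames if every formula of $L$ is valid in all frames of $\mathcal C$ (respectively every formula valid in all frames of $\mathcal C$ is in $L$). **Q-filter frames.** Let $A$ be a modal algebra (a Boolean algebra with a unary operation $\Box$; $\Diamond x=-\Box-x$) and $S\subseteq\mathcal P(A)$. A *Q-filter for $S$* is a proper prime filter $F$ of $A$ such that $\bigwedge X\in F$ for every $X\in S$ with $X\subseteq F$ whose meet exists in $A$; $\mathcal F_S(A)$ is the set of these. $\mathsf{Frm}_S(A)=\langle\mathcal F_S(A),\mathcal N\rangle$ with $\mathcal N(F)=\{\{G\mid x\in G\}\mid \Box x\in F\}$. For a map $\mathcal N:\mathcal F_S(A)\to\mathcal P(\mathcal P(\mathcal F_S(A)))$ with $$\Box^{-1}F\subseteq\bigcup_{X\in\mathcal N(F)}\bigcap X,\qquad \Diamond^{-1}F\subseteq\bigcap_{X\in\mathcal N(F)}\bigcup X\qquad(F\in\mathcal F_S(A)),\tag{$*$}$$ let $\mathsf{Frm}_{S,\mathcal N}(A)=\langle\mathcal F_S(A),{\uparrow}\mathcal N\rangle$, where ${\uparrow}\mathcal N(F)$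 is the set of supersets of members of $\mathcal N(F)$. (Here $\bigcap\emptyset=A$.) **Statement.** Let $L$ be a predicate modal logic that admits every member of a countable set $R$ of $\omega$-pairs, each of which satisfies $|\{\{s(\beta_i)\mid i\in\omega\}\mid s\in\mathsf{Sub}\}|\le\aleph_0$. Let $A_L$ be the Lindenbaum algebra of $L$, i.e. $\Phi$ modulo $\phi\sim\psi\Leftrightarrow\phi\equiv\psi\in L$, with classes $[\phi]$ and the operations induced by the logical symbols. Let $S=S_1\cup S_2$, where $$S_1=\{\{[s(\beta_i)]\mid i\in\omega\}\mid (\alpha,(\beta_i))\in R,\ s\in\mathsf{Sub}\},\qquad S_2=\{\{[[y/x]\phi]\mid y\in\mathsf V\}\mid \forall x\phi\in\Phi\}.$$ 1. If $\mathsf{Frm}_S(A_L)\in\mathscr C(L)$, then $L$ is sound and complete with respect to $\mathscr C(L)$. 2. Suppose $L$ satisfies $\mathrm{MT}$. If there is a map $\mathcal N$ satisfying $(*)$ (for $A=A_L$) with $\mathsf{Frm}_{S,\mathcal N}(A_L)\in\mathscr C(L)$, then $L$ is sound and complete with respect to $\mathscr C(L)$. (If $\mathcal F_S(A_L)=\emptyset$,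 which happens only for inconsistent $L$, the membership conditions in 1 and 2 are regarded as satisfied.) -/

import Mathlib

universe u

namespace PML

/-! ## Formulas -/

/-- Formulas of predicate modal logic over a set `V` of variables and sets `Pred n` of
`n`-ary predicate symbols. -/
inductive Formula (V : Type u) (Pred : ℕ → Type u) : Type u
  | top : Formula V Pred
  | bot : Formula V Pred
  | atom {n : ℕ} (P : Pred n) (x : Fin n → V) : Formula V Pred
  | and (φ ψ : Formula V Pred) : Formula V Pred
  | neg (φ : Formula V Pred) : Formula V Pred
  | box (φ : Formula V Pred) : Formula V Pred
  | all (x : V) (φ : Formula V Pred) : Formula V Pred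

namespace Formula

variable {V : Type u} {Pred : ℕ → Type u}

/-- `φ ∨ ψ`. -/
def or (φ ψ : Formula V Pred) : Formula V Pred := neg (and (neg φ) (neg ψ))

/-- `φ ⊃ ψ`. -/
def imp (φ ψ : Formula V Pred) : Formula V Pred := neg (and φ (neg ψ))

/-- `φ ≡ ψ`. -/
def iff (φ ψ : Formula V Pred) : Formula V Pred := and (imp φ ψ) (imp ψ φ)

open Classical in
/-- The free variables of a formula. -/
noncomputable def freeVars : Formula V Pred → Finset V
  | top => ∅
  | bot => ∅
  | atom _ x => Finset.univ.image x
  | and φ ψ => freeVars φ ∪ freeVars ψ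
  | neg φ => freeVars φ
  | box φ => freeVars φ
  | all x φ => (freeVars φ).erase x

/-- A formula without free variables. -/
def IsClosed (φ : Formula V Pred) : Prop := φ.freeVars = ∅

open Classical in
/-- The variable `x` itself if it is not in the finite set `s`, otherwise some variable
outside `s`. -/
noncomputable def freshVar [Infinite V] (x : V) (s : Finset V) : V :=
  if x ∉ s then x else Classical.choose (Infinite.exists_notMem_finset s)

open Classical in
/-- Simultaneous capture-avoiding substitution of the variable `σ x` for every free occurrence
of `x`.  A bound variable is renamed exactly when it would capture. -/
noncomputable def rename [Infinite V] : Formula V Pred → (V → V) → Formula V Pred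
  | top, _ => top
  | bot, _ => bot
  | atom P x, σ => atom P (fun i => σ (x i))
  | and φ ψ, σ => and (rename φ σ) (rename ψ σ)
  | neg φ, σ => neg (rename φ σ)
  | box φ, σ => box (rename φ σ)
  | all x φ, σ =>
      all (freshVar x (((freeVars φ).erase x).image σ))
        (rename φ (Function.update σ x (freshVar x (((freeVars φ).erase x).image σ))))

open Classical in
/-- `[y/x]φ`: the capture-avoiding substitution of `y` for the free occurrences of `x`. -/
noncomputable def inst [Infinite V] (y x : V) (φ : Formula V Pred) : Formula V Pred :=
  φ.rename (Function.update id x y)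

/-- Propositional tautologies: formulas that are true under all truth assignments that respect
the propositional connectives (all other formulas being treated as atoms). -/
def IsTautology (φ : Formula V Pred) : Prop :=
  ∀ v : Formula V Pred → Prop, v top → ¬ v bot → (∀ a b, v (and a b) ↔ v a ∧ v b) →
    (∀ a, v (neg a) ↔ ¬ v a) → v φ

/-- The classical predicate tautologies in the modal language: the theorems of the classical
predicate calculus, in which boxed formulas have no specific axioms. -/
inductive IsClassical [Infinite V] : Formula V Pred → Prop
  | taut {φ : Formula V Pred} : IsTautology φ → IsClassical φ
  | allElim (x y : V) (φ : Formula V Pred) : IsClassical (imp (all x φ) (inst y x φ))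
  | allImp (x : V) (φ ψ : Formula V Pred) : x ∉ freeVars φ →
      IsClassical (imp (all x (imp φ ψ)) (imp φ (all x ψ)))
  | mp {φ ψ : Formula V Pred} : IsClassical φ → IsClassical (imp φ ψ) → IsClassical ψ
  | gen (x : V) {φ : Formula V Pred} : IsClassical φ → IsClassical (all x φ)

end Formula

open Formula

/-! ## Uniform substitution of formulas for predicate symbols -/

/-- The data of a uniform substitution: every predicate symbol `P` of arity `n` is assigned
an abstraction `λ z₁ … zₙ, θ`, where `z = args P` are distinct variables and
`θ = body P` is a formula, which may have further free variables (parameters). -/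
structure PredSubst (V : Type u) (Pred : ℕ → Type u) where
  args : {n : ℕ} → Pred n → (Fin n ↪ V)
  body : {n : ℕ} → Pred n → Formula V Pred

namespace PredSubst

variable {V : Type u} {Pred : ℕ → Type u}

open Classical in
/-- The parameters of the abstractions assigned to the predicate symbols that occur in a
formula. -/
noncomputable def paramsIn (s : PredSubst V Pred) : Formula V Pred → Finset V
  | .top => ∅
  | .bot => ∅
  | .atom P _ => (s.body P).freeVars \ Finset.univ.image (s.args P)
  | .and φ ψ => paramsIn s φ ∪ paramsIn s ψ
  | .neg φ => paramsIn s φ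
  | .box φ => paramsIn s φ
  | .all _ φ => paramsIn s φ

open Classical in
/-- Auxiliary recursion for `PredSubst.apply`: apply `s` to the predicate symbols and, at the
same time, `σ` to the free variables, without capture.  An atom `P(x₁,…,xₙ)` becomes the body
of `P` with `σ xᵢ` substituted for the `i`-th argument variable. -/
noncomputable def applyAux [Infinite V] (s : PredSubst V Pred) :
    Formula V Pred → (V → V) → Formula V Pred
  | .top, _ => .top
  | .bot, _ => .bot
  | .atom P x, σ => (s.body P).rename (Function.extend (s.args P) (fun i => σ (x i)) id)
  | .and φ ψ, σ => .and (applyAux s φ σ) (applyAux s ψ σ)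
  | .neg φ, σ => .neg (applyAux s φ σ)
  | .box φ, σ => .box (applyAux s φ σ)
  | .all x φ, σ =>
      .all (freshVar x (((freeVars φ).erase x).image σ ∪ paramsIn s φ))
        (applyAux s φ (Function.update σ x
          (freshVar x (((freeVars φ).erase x).image σ ∪ paramsIn s φ))))

/-- The function `Φ → Φ` given by a uniform substitution. -/
noncomputable def apply [Infinite V] (s : PredSubst V Pred) (φ : Formula V Pred) :
    Formula V Pred :=
  applyAux s φ id

end PredSubst

/-! ## Neighborhood frames and models -/

/-- Neighborhood frames. -/
structure NeighborhoodFrame : Type (u + 1) where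
  carrier : Type u
  nonempty : Nonempty carrier
  nbhd : carrier → Set (Set carrier)

section Semantics

variable {V : Type u} {Pred : ℕ → Type u}

open Classical in
/-- The valuation of formulas in the neighborhood model on the frame `Z` with constant domain
`D` and interpretation `I`, under the assignment `a`. -/
def val (Z : NeighborhoodFrame.{u}) {D : Type u}
    (I : {n : ℕ} → Pred n → Z.carrier → Set (Fin n → D)) :
    Formula V Pred → (V → D) → Set Z.carrier
  | .top, _ => Set.univ
  | .bot, _ => ∅
  | .atom P x, a => {c | (fun i => a (x i)) ∈ I P c}
  | .and φ ψ, a => val Z I φ a ∩ val Z I ψ a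
  | .neg φ, a => (val Z I φ a)ᶜ
  | .box φ, a => {c | val Z I φ a ∈ Z.nbhd c}
  | .all x φ, a => ⋂ d : D, val Z I φ (Function.update a x d)

/-- `Z ⊨ φ`: the formula holds at all points under all assignments, for all non-empty domains
and all interpretations. -/
def NeighborhoodFrame.Validates (Z : NeighborhoodFrame.{u}) (φ : Formula V Pred) : Prop :=
  ∀ (D : Type u) [Nonempty D] (I : {n : ℕ} → Pred n → Z.carrier → Set (Fin n → D))
    (a : V → D) (c : Z.carrier), c ∈ val Z I φ a

/-- `𝒞(Γ)`, the class of neighborhood frames that validate `Γ`. -/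
def frameClass (Γ : Set (Formula V Pred)) : Set NeighborhoodFrame.{u} :=
  {Z | ∀ φ ∈ Γ, Z.Validates φ}

/-- `ℒ(𝒞)`, the set of formulas that are valid in all frames of the class `𝒞`. -/
def logicOf (𝒞 : Set NeighborhoodFrame.{u}) : Set (Formula V Pred) :=
  {φ | ∀ Z ∈ 𝒞, Z.Validates φ}

end Semantics

/-! ## Predicate modal logics and ω-rules -/

/-- Predicate modal logics, as sets of formulas. -/
structure PredicateModalLogic (V : Type u) (Pred : ℕ → Type u) [Infinite V] where
  carrier : Set (Formula V Pred)
  classical : ∀ φ, IsClassical φ → φ ∈ carrier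
  mp : ∀ φ ψ, φ ∈ carrier → imp φ ψ ∈ carrier → ψ ∈ carrier
  subst : ∀ (s : PredSubst V Pred) (φ), φ ∈ carrier → s.apply φ ∈ carrier
  gen : ∀ (x : V) (φ), φ ∈ carrier → all x φ ∈ carrier
  congr : ∀ φ ψ, iff φ ψ ∈ carrier → iff (box φ) (box ψ) ∈ carrier

/-- A pair consisting of the axiom schemata `α ⊃ βᵢ` (`i ∈ ω`) and the ω-rule
"from `p ⊃ βᵢ` (`i ∈ ω`) infer `p ⊃ α`", where `α` and all `βᵢ` are closed. -/
structure OmegaPair (V : Type u) (Pred : ℕ → Type u) where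
  α : Formula V Pred
  β : ℕ → Formula V Pred
  α_closed : α.IsClosed
  β_closed : ∀ i, (β i).IsClosed

/-- There are at most countably many sets `{s(βᵢ) | i ∈ ω}`, where `s` ranges over the uniform
substitutions. -/
def OmegaPair.CountablyManyInstances {V : Type u} {Pred : ℕ → Type u} [Infinite V]
    (r : OmegaPair V Pred) : Prop :=
  {X : Set (Formula V Pred) | ∃ s : PredSubst V Pred,
    X = Set.range (fun i => s.apply (r.β i))}.Countable

namespace PredicateModalLogic

variable {V : Type u} {Pred : ℕ → Type u} [Infinite V] (L : PredicateModalLogic V Pred)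

/-- The logic admits the axiom schemata and the ω-rule of the pair `r`. -/
def Admits (r : OmegaPair V Pred) : Prop :=
  (∀ (s : PredSubst V Pred) (i : ℕ), s.apply (imp r.α (r.β i)) ∈ L.carrier) ∧
  ∀ (s : PredSubst V Pred) (φ : Formula V Pred),
    (∀ i, imp φ (s.apply (r.β i)) ∈ L.carrier) → imp φ (s.apply r.α) ∈ L.carrier

/-- The monotonicity condition `MT`, as the schema `□(φ ∧ ψ) ⊃ □φ ∧ □ψ`. -/
def IsMonotonic : Prop :=
  ∀ φ ψ : Formula V Pred, imp (box (and φ ψ)) (and (box φ) (box ψ)) ∈ L.carrier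

/-- Soundness with respect to a class of neighborhood frames. -/
def IsSound (𝒞 : Set NeighborhoodFrame.{u}) : Prop := L.carrier ⊆ logicOf 𝒞

/-- Completeness with respect to a class of neighborhood frames. -/
def IsComplete (𝒞 : Set NeighborhoodFrame.{u}) : Prop := logicOf 𝒞 ⊆ L.carrier

variable {L}

theorem mem_of_taut {φ : Formula V Pred} (h : IsTautology φ) : φ ∈ L.carrier :=
  L.classical _ (.taut h)

theorem mem_of_taut₁ {φ ψ : Formula V Pred} (h₁ : φ ∈ L.carrier)
    (h : IsTautology (imp φ ψ)) : ψ ∈ L.carrier :=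
  L.mp _ _ h₁ (mem_of_taut h)

theorem mem_of_taut₂ {φ ψ χ : Formula V Pred} (h₁ : φ ∈ L.carrier) (h₂ : ψ ∈ L.carrier)
    (h : IsTautology (imp φ (imp ψ χ))) : χ ∈ L.carrier :=
  L.mp _ _ h₂ (mem_of_taut₁ h₁ h)

variable (L)

/-- The equivalence `φ ≡ ψ ∈ L`. -/
def setoid : Setoid (Formula V Pred) where
  r φ ψ := iff φ ψ ∈ L.carrier
  iseqv := by
    refine ⟨fun φ => mem_of_taut ?_, fun {φ ψ} h => mem_of_taut₁ h ?_,
      fun {φ ψ χ} h₁ h₂ => mem_of_taut₂ h₁ h₂ ?_⟩ <;>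
    · intro v _ _ ha hn
      simp only [iff, imp, ha, hn]
      tauto

/-- The Lindenbaum algebra of `L`. -/
def Lindenbaum : Type u := Quotient L.setoid

/-- The class `[φ]` of a formula in the Lindenbaum algebra. -/
def cls (φ : Formula V Pred) : L.Lindenbaum := Quotient.mk L.setoid φ

end PredicateModalLogic

/-! ## Modal algebras -/

/-- Modal algebras: Boolean algebras with an arbitrary unary operation. -/
class ModalAlgebra (A : Type u) extends BooleanAlgebra A where
  box : A → A

/-- `◇x = -□-x`. -/
def ModalAlgebra.dia {A : Type u} [ModalAlgebra A] (x : A) : A := (ModalAlgebra.box xᶜ)ᶜ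

/-- The Lindenbaum algebra is a modal algebra, with operations given by the logical symbols;
`[φ] ≤ [ψ]` means `φ ⊃ ψ ∈ L`. -/
instance PredicateModalLogic.instModalAlgebra {V : Type u} {Pred : ℕ → Type u} [Infinite V]
    (L : PredicateModalLogic V Pred) : ModalAlgebra L.Lindenbaum where
  le := Quotient.lift₂ (fun φ ψ => imp φ ψ ∈ L.carrier) (by
    intro a b a' b' h₁ h₂
    refine propext ⟨fun h => ?_, fun h => ?_⟩
    · refine L.mp _ _ h (mem_of_taut₂ h₁ h₂ ?_)
      intro v _ _ ha hn
      simp only [iff, imp, ha, hn]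
      tauto
    · refine L.mp _ _ h (mem_of_taut₂ h₁ h₂ ?_)
      intro v _ _ ha hn
      simp only [iff, imp, ha, hn]
      tauto)
  le_refl := by
    rintro ⟨a⟩
    refine mem_of_taut (L := L) ?_
    intro v _ _ ha hn
    simp only [imp, ha, hn]
    tauto
  le_trans := by
    rintro ⟨a⟩ ⟨b⟩ ⟨c⟩ h₁ h₂
    refine mem_of_taut₂ (L := L) h₁ h₂ ?_
    intro v _ _ ha hn
    simp only [imp, ha, hn]
    tauto
  le_antisymm := by
    rintro ⟨a⟩ ⟨b⟩ h₁ h₂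
    refine Quotient.sound (mem_of_taut₂ (L := L) h₁ h₂ ?_)
    intro v _ _ ha hn
    simp only [iff, imp, ha, hn]
    tauto
  sup := Quotient.map₂ Formula.or (by
    intro a a' h₁ b b' h₂
    refine mem_of_taut₂ (L := L) h₁ h₂ ?_
    intro v _ _ ha hn
    simp only [iff, imp, Formula.or, ha, hn]
    tauto)
  le_sup_left := by
    rintro ⟨a⟩ ⟨b⟩
    refine mem_of_taut (L := L) ?_
    intro v _ _ ha hn
    simp only [imp, Formula.or, ha, hn]
    tauto
  le_sup_right := by
    rintro ⟨a⟩ ⟨b⟩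
    refine mem_of_taut (L := L) ?_
    intro v _ _ ha hn
    simp only [imp, Formula.or, ha, hn]
    tauto
  sup_le := by
    rintro ⟨a⟩ ⟨b⟩ ⟨c⟩ h₁ h₂
    refine mem_of_taut₂ (L := L) h₁ h₂ ?_
    intro v _ _ ha hn
    simp only [imp, Formula.or, ha, hn]
    tauto
  inf := Quotient.map₂ Formula.and (by
    intro a a' h₁ b b' h₂
    refine mem_of_taut₂ (L := L) h₁ h₂ ?_
    intro v _ _ ha hn
    simp only [iff, imp, ha, hn]
    tauto)
  inf_le_left := by
    rintro ⟨a⟩ ⟨b⟩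
    refine mem_of_taut (L := L) ?_
    intro v _ _ ha hn
    simp only [imp, ha, hn]
    tauto
  inf_le_right := by
    rintro ⟨a⟩ ⟨b⟩
    refine mem_of_taut (L := L) ?_
    intro v _ _ ha hn
    simp only [imp, ha, hn]
    tauto
  le_inf := by
    rintro ⟨a⟩ ⟨b⟩ ⟨c⟩ h₁ h₂
    refine mem_of_taut₂ (L := L) h₁ h₂ ?_
    intro v _ _ ha hn
    simp only [imp, ha, hn]
    tauto
  le_sup_inf := by
    rintro ⟨a⟩ ⟨b⟩ ⟨c⟩
    refine mem_of_taut (L := L) ?_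
    intro v _ _ ha hn
    simp only [imp, Formula.or, ha, hn]
    tauto
  top := L.cls .top
  bot := L.cls .bot
  compl := Quotient.map Formula.neg (by
    intro a a' h₁
    refine mem_of_taut₁ (L := L) h₁ ?_
    intro v _ _ ha hn
    simp only [iff, imp, ha, hn]
    tauto)
  inf_compl_le_bot := by
    rintro ⟨a⟩
    refine mem_of_taut (L := L) ?_
    intro v _ _ ha hn
    simp only [imp, ha, hn]
    tauto
  top_le_sup_compl := by
    rintro ⟨a⟩
    refine mem_of_taut (L := L) ?_
    intro v _ _ ha hn
    simp only [imp, Formula.or, ha, hn]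
    tauto
  le_top := by
    rintro ⟨a⟩
    refine mem_of_taut (L := L) ?_
    intro v ht _ ha hn
    simp only [imp, ha, hn]
    tauto
  bot_le := by
    rintro ⟨a⟩
    refine mem_of_taut (L := L) ?_
    intro v _ hb ha hn
    simp only [imp, ha, hn]
    tauto
  box := Quotient.map Formula.box (fun _ _ h => L.congr _ _ h)

/-! ## Q-filters and Q-filter neighborhood frames -/

/-- Q-filters for `S ⊆ 𝒫(A)`: the proper prime filters that are closed under the existing meets
of members of `S`. -/
structure QFilter {A : Type u} [BooleanAlgebra A] (S : Set (Set A)) where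
  filter : Order.PFilter A
  bot_notMem : ⊥ ∉ filter
  prime : ∀ x y : A, x ⊔ y ∈ filter → x ∈ filter ∨ y ∈ filter
  meet_mem : ∀ X ∈ S, ∀ m : A, IsGLB X m → (∀ x ∈ X, x ∈ filter) → m ∈ filter

section QFilterFrames

variable {A : Type u} [ModalAlgebra A]

/-- The Q-filter neighborhood frame of `A` for `S` (defined if there is a Q-filter). -/
def qFilterFrame (S : Set (Set A)) (h : Nonempty (QFilter S)) : NeighborhoodFrame.{u} where
  carrier := QFilter S
  nonempty := h
  nbhd F := {X | ∃ x : A, ModalAlgebra.box x ∈ F.filter ∧ X = {G | x ∈ G.filter}}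

/-- The condition `□⁻¹F ⊆ ⋃_{X ∈ N(F)} ⋂ X` and `◇⁻¹F ⊆ ⋂_{X ∈ N(F)} ⋃ X` for all `F` on a
neighborhood system `N` on the set of Q-filters. -/
def IsQSystem {S : Set (Set A)} (N : QFilter S → Set (Set (QFilter S))) : Prop :=
  ∀ F : QFilter S,
    {x : A | ModalAlgebra.box x ∈ F.filter} ⊆ ⋃ X ∈ N F, ⋂ G ∈ X, {x : A | x ∈ G.filter} ∧
    {x : A | ModalAlgebra.dia x ∈ F.filter} ⊆ ⋂ X ∈ N F, ⋃ G ∈ X, {x : A | x ∈ G.filter}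

/-- The neighborhood frame on the Q-filters in which the neighborhoods of `F` are the supersets
of the members of `N F` (defined if there is a Q-filter). -/
def qFilterFrameOf {S : Set (Set A)} (N : QFilter S → Set (Set (QFilter S)))
    (h : Nonempty (QFilter S)) : NeighborhoodFrame.{u} where
  carrier := QFilter S
  nonempty := h
  nbhd F := {Y | ∃ X ∈ N F, X ⊆ Y}

end QFilterFrames

/-- The set `S = S₁ ∪ S₂` of subsets of the Lindenbaum algebra: `S₁` consists of the sets
`{[s(βᵢ)] | i ∈ ω}` for the pairs in `R` and the uniform substitutions `s`, and `S₂` of the sets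
`{[[y/x]φ] | y ∈ V}` for the formulas `∀x φ`. -/
def PredicateModalLogic.meetSets {V : Type u} {Pred : ℕ → Type u} [Infinite V]
    (L : PredicateModalLogic V Pred) (R : Set (OmegaPair V Pred)) : Set (Set L.Lindenbaum) :=
  {X | ∃ r ∈ R, ∃ s : PredSubst V Pred, X = Set.range (fun i => L.cls (s.apply (r.β i)))} ∪
  {X | ∃ (x : V) (φ : Formula V Pred), X = Set.range (fun y => L.cls (inst y x φ))}

end PML

open PML

namespace PML

open Function

/-! ## Syntax: variable substitution -/

namespace Formula

variable {V : Type u} {Pred : ℕ → Type u}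

/-! Soundness is immediate from the definition of `frameClass`; completeness comes from a canonical
model whose points are the Q-filters. The language is countable, so the Lindenbaum algebra and
`L.meetSets R` are countable, and the Rasiowa–Sikorski lemma (`QFilter.exists_mem`) places every
nonzero element in a Q-filter. Hence Q-filters separate elements (`QFilter.le_of_forall_mem`).

The domain of the canonical model is `V`, so an assignment `a : V → V` is also a renaming. The truth
lemma `val_canonical` states that `φ` holds at `F` under `a` iff `[φ.rename a] ∈ F`. Its quantifier
case holds because `[∀x φ]` is the meet of the classes `[[y/x]φ]` (`isGLB_cls_all`), a meet that
Q-filters preserve. Its box case needs only that `{G | x ∈ G}` is a neighborhood of `F` iff `□x ∈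
F`; both frames satisfy this, the first by separation and the second by `IsQSystem`.

If such a frame validates `L`, a formula valid throughout the class holds at every Q-filter under
the identity assignment, so its class lies in every Q-filter and equals `⊤`. -/

open Classical in
theorem update_eq_of_notMem_image_erase {s : Finset V} {σ : V → V} {x z y : V}
    (hz : z ∉ (s.erase x).image σ) (hy : y ∈ s) :
    update σ x z y = z ↔ y = x := by
  by_cases h : y = x
  · simp [h]
  · rw [update_of_ne h]
    refine ⟨fun e => (hz ?_).elim, fun e => (h e).elim⟩
    exact Finset.mem_image.2 ⟨y, Finset.mem_erase.2 ⟨h, hy⟩, e⟩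

-- When `z` captures nothing, `x` is the only element of `s` sent to `z`, so erasing `z` from the
-- image removes exactly the contribution of `x`.
open Classical in
theorem erase_image_update {s : Finset V} {σ : V → V} {x z : V}
    (hz : z ∉ (s.erase x).image σ) :
    (s.image (update σ x z)).erase z = (s.erase x).image σ := by
  ext w
  simp only [Finset.mem_erase, Finset.mem_image]
  constructor
  · rintro ⟨hw, y, hy, rfl⟩
    have hne : y ≠ x := fun e => hw ((update_eq_of_notMem_image_erase hz hy).2 e)
    exact ⟨y, ⟨hne, hy⟩, (update_of_ne hne _ _).symm⟩
  · rintro ⟨y, ⟨hne, hy⟩, rfl⟩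
    have e : update σ x z y = σ y := update_of_ne hne _ _
    refine ⟨fun h => hne ?_, y, hy, e⟩
    rw [← update_eq_of_notMem_image_erase hz hy, e, h]

section Rename

variable [Infinite V]

theorem freshVar_notMem (x : V) (s : Finset V) : freshVar x s ∉ s := by
  by_cases h : x ∉ s
  · rwa [freshVar, if_pos h]
  · rw [freshVar, if_neg h]
    exact Classical.choose_spec (Infinite.exists_notMem_finset s)

theorem freshVar_eq_self {x : V} {s : Finset V} (h : x ∉ s) : freshVar x s = x :=
  if_pos h

open Classical in
theorem freeVars_rename (φ : Formula V Pred) (σ : V → V) :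
    (φ.rename σ).freeVars = φ.freeVars.image σ := by
  induction φ generalizing σ with
  | top => simp [rename, freeVars]
  | bot => simp [rename, freeVars]
  | atom P x => simp [rename, freeVars, Finset.image_image, Function.comp_def]
  | and φ ψ h₁ h₂ => simp [rename, freeVars, Finset.image_union, h₁, h₂]
  | neg φ h => simp [rename, freeVars, h]
  | box φ h => simp [rename, freeVars, h]
  | all x φ h =>
    simp only [rename, freeVars, h]
    exact erase_image_update (freshVar_notMem _ _)

theorem rename_congr (φ : Formula V Pred) {σ τ : V → V} (h : ∀ x ∈ φ.freeVars, σ x = τ x) :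
    φ.rename σ = φ.rename τ := by
  classical
  induction φ generalizing σ τ with
  | top => rfl
  | bot => rfl
  | atom P x =>
    simp only [rename]
    congr 1
    funext i
    exact h _ (by simp [freeVars])
  | and φ ψ h₁ h₂ =>
    simp only [freeVars, Finset.mem_union] at h
    simp only [rename]
    rw [h₁ fun x hx => h x (.inl hx), h₂ fun x hx => h x (.inr hx)]
  | neg φ ih => simp only [rename]; rw [ih h]
  | box φ ih => simp only [rename]; rw [ih h]
  | all x φ ih =>
    simp only [freeVars] at h
    have e : (φ.freeVars.erase x).image σ = (φ.freeVars.erase x).image τ :=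
      Finset.image_congr fun y hy => h y (Finset.mem_coe.1 hy)
    simp only [rename]
    rw [e]
    congr 1
    refine ih fun y hy => ?_
    by_cases hyx : y = x
    · simp [hyx]
    · simp only [update_of_ne hyx]
      exact h y (Finset.mem_erase.2 ⟨hyx, hy⟩)

theorem rename_id (φ : Formula V Pred) : φ.rename id = φ := by
  induction φ with
  | top => rfl
  | bot => rfl
  | atom P x => rfl
  | and φ ψ h₁ h₂ => simp only [rename, h₁, h₂]
  | neg φ ih => simp only [rename, ih]
  | box φ ih => simp only [rename, ih]
  | all x φ ih =>
    classical
    have e : freshVar x ((φ.freeVars.erase x).image id) = x :=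
      freshVar_eq_self (by simp)
    simp only [rename]
    rw [e]
    have : update (id : V → V) x x = id := update_eq_self x id
    rw [this, ih]

theorem inst_self (x : V) (φ : Formula V Pred) : inst x x φ = φ := by
  classical
  rw [inst, rename_congr φ (τ := id) fun y _ => ?_, rename_id]
  exact congrFun (update_eq_self x id) y

end Rename

/-! ## Countability of the language -/

/-- The formulas of construction depth less than `n`. -/
def ofDepth (V : Type u) (Pred : ℕ → Type u) : ℕ → Set (Formula V Pred)
  | 0 => ∅
  | n + 1 =>
    {top, bot} ∪ Set.range (fun p : Σ n, Pred n × (Fin n → V) => atom p.2.1 p.2.2) ∪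
      Set.image2 and (ofDepth V Pred n) (ofDepth V Pred n) ∪ neg '' ofDepth V Pred n ∪
      box '' ofDepth V Pred n ∪ Set.image2 all Set.univ (ofDepth V Pred n)

theorem ofDepth_mono : Monotone (ofDepth V Pred) := by
  refine monotone_nat_of_le_succ fun n => ?_
  induction n with
  | zero => exact Set.empty_subset _
  | succ n ih =>
    rw [ofDepth, ofDepth]
    have h₂ := Set.image2_subset (f := and) ih ih
    have h₃ := Set.image_mono (f := neg) ih
    have h₄ := Set.image_mono (f := box) ih
    have h₅ := Set.image2_subset (f := all) (Set.Subset.refl Set.univ) ih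
    exact Set.union_subset_union (Set.union_subset_union (Set.union_subset_union
      (Set.union_subset_union subset_rfl h₂) h₃) h₄) h₅

theorem exists_mem_ofDepth (φ : Formula V Pred) : ∃ n, φ ∈ ofDepth V Pred n := by
  induction φ with
  | top => exact ⟨1, by simp [ofDepth]⟩
  | bot => exact ⟨1, by simp [ofDepth]⟩
  | @atom n P x =>
    exact ⟨1, .inl (.inl (.inl (.inl (.inr ⟨⟨n, P, x⟩, rfl⟩))))⟩
  | and φ ψ h₁ h₂ =>
    obtain ⟨m, hm⟩ := h₁
    obtain ⟨n, hn⟩ := h₂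
    exact ⟨max m n + 1, .inl (.inl (.inl (.inr
      ⟨φ, ofDepth_mono (le_max_left m n) hm, ψ, ofDepth_mono (le_max_right m n) hn, rfl⟩)))⟩
  | neg φ h => exact h.imp' (· + 1) fun n hn => .inl (.inl (.inr ⟨φ, hn, rfl⟩))
  | box φ h => exact h.imp' (· + 1) fun n hn => .inl (.inr ⟨φ, hn, rfl⟩)
  | all x φ h => exact h.imp' (· + 1) fun n hn => .inr ⟨x, trivial, φ, hn, rfl⟩

theorem countable_ofDepth [Countable V] [∀ n, Countable (Pred n)] (n : ℕ) :
    (ofDepth V Pred n).Countable := by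
  induction n with
  | zero => exact Set.countable_empty
  | succ n ih =>
    exact (((((Set.toFinite _).countable.union (Set.countable_range _)).union
      (ih.image2 ih _)).union (ih.image _)).union (ih.image _)).union
      (Set.countable_univ.image2 ih _)

instance [Countable V] [∀ n, Countable (Pred n)] : Countable (Formula V Pred) := by
  rw [← Set.countable_univ_iff]
  refine (Set.countable_iUnion (countable_ofDepth (V := V) (Pred := Pred))).mono fun φ _ => ?_
  exact Set.mem_iUnion.2 (exists_mem_ofDepth φ)

end Formula

end PML

namespace PML

open Formula

/-! ## The Rasiowa–Sikorski lemma -/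

section RasiowaSikorski

variable {A : Type u} [BooleanAlgebra A]

open OrderDual in
/-- A countable family of sets, each of which is dense below every nonzero element of a Boolean
algebra, has a generic filter base below every nonzero element. -/
theorem exists_generic {ι : Type*} [Countable ι] (D : ι → Set A)
    (hD : ∀ i, ∀ b : A, b ≠ ⊥ → ∃ c ≤ b, c ≠ ⊥ ∧ c ∈ D i) {a : A} (ha : a ≠ ⊥) :
    ∃ G : Set A, a ∈ G ∧ ⊥ ∉ G ∧ DirectedOn (· ≥ ·) G ∧ ∀ i, ∃ c ∈ G, c ∈ D i := by
  have := Encodable.ofCountable ι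
  -- Density below nonzero elements is cofinality in the order dual, where ideals are downward
  -- directed sets of nonzero elements of `A`.
  let 𝒟 : ι → Order.Cofinal {b : A // b ≠ ⊥}ᵒᵈ := fun i =>
    ⟨{b | (ofDual b).1 ∈ D i}, fun b => by
      obtain ⟨c, hcb, hc, hcD⟩ := hD i (ofDual b).1 (ofDual b).2
      exact ⟨toDual ⟨c, hc⟩, hcD, hcb⟩⟩
  let J := Order.idealOfCofinals (toDual (⟨a, ha⟩ : {b : A // b ≠ ⊥})) 𝒟
  refine ⟨{b | ∃ h : b ≠ ⊥, toDual (⟨b, h⟩ : {b : A // b ≠ ⊥}) ∈ J},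
    ⟨ha, Order.mem_idealOfCofinals _ _⟩, fun h => h.1 rfl, ?_, fun i => ?_⟩
  · rintro b ⟨hb, hbJ⟩ c ⟨hc, hcJ⟩
    obtain ⟨d, hd, hbd, hcd⟩ := J.directed _ hbJ _ hcJ
    exact ⟨(ofDual d).1, ⟨(ofDual d).2, hd⟩, hbd, hcd⟩
  · obtain ⟨c, hcD, hcJ⟩ := Order.cofinal_meets_idealOfCofinals
      (toDual (⟨a, ha⟩ : {b : A // b ≠ ⊥})) 𝒟 i
    exact ⟨(ofDual c).1, ⟨(ofDual c).2, hcJ⟩, hcD⟩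

/-- In a countable Boolean algebra, every nonzero element belongs to a Q-filter for any countable
set of subsets. -/
theorem QFilter.exists_mem [Countable A] {S : Set (Set A)} (hS : S.Countable) {a : A}
    (ha : a ≠ ⊥) : ∃ F : QFilter S, a ∈ F.filter := by
  have := hS.to_subtype
  -- The left sets decide each `x`, which yields primeness. The right sets force, for each meet `m`
  -- of `X`, either `m` itself or the complement of some member of `X`.
  let D : A ⊕ (S × A) → Set A := Sum.elim (fun x => {b | b ≤ x ∨ b ≤ xᶜ})
    (fun p => {b | IsGLB p.1.1 p.2 → b ≤ p.2 ∨ ∃ x ∈ p.1.1, b ≤ xᶜ})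
  have inf_ne {b x : A} (h : ¬ b ≤ x) : b ⊓ xᶜ ≠ ⊥ := fun e => h (by
    rwa [← sdiff_eq, sdiff_eq_bot_iff] at e)
  obtain ⟨G, haG, hbot, hdir, hG⟩ := exists_generic D (fun i b hb => by
    rcases i with x | ⟨X, m⟩
    · by_cases h : b ≤ x
      · exact ⟨b, le_rfl, hb, .inl h⟩
      · exact ⟨b ⊓ xᶜ, inf_le_left, inf_ne h, .inr inf_le_right⟩
    · by_cases hm : IsGLB X.1 m
      · by_cases h : b ≤ m
        · exact ⟨b, le_rfl, hb, fun _ => .inl h⟩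
        -- Since `m` is the greatest lower bound, `b ≰ m` gives some `x ∈ X` with `b ≰ x`, and `b ⊓
        -- xᶜ` is then nonzero.
        · rw [le_isGLB_iff hm, mem_lowerBounds] at h
          push Not at h
          obtain ⟨x, hx, h⟩ := h
          exact ⟨b ⊓ xᶜ, inf_le_left, inf_ne h, fun _ => .inr ⟨x, hx, inf_le_right⟩⟩
      · exact ⟨b, le_rfl, hb, fun h => (hm h).elim⟩) ha
  have hF : Order.IsPFilter {x : A | ∃ b ∈ G, b ≤ x} := by
    refine .of_def ⟨a, a, haG, le_rfl⟩ ?_ fun hxy ⟨b, hb, h⟩ => ⟨b, hb, h.trans hxy⟩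
    rintro x ⟨b, hb, hbx⟩ y ⟨c, hc, hcy⟩
    obtain ⟨d, hd, hdb, hdc⟩ := hdir b hb c hc
    exact ⟨d, ⟨d, hd, le_rfl⟩, le_trans hdb hbx, le_trans hdc hcy⟩
  have incompat {b c x : A} (hb : b ∈ G) (hc : c ∈ G) (hbx : b ≤ x) (hcx : c ≤ xᶜ) : False := by
    obtain ⟨d, hd, hdb, hdc⟩ := hdir b hb c hc
    have : d ≤ ⊥ := (le_inf (le_trans hdb hbx) (le_trans hdc hcx)).trans (inf_compl_eq_bot (a := x)).le
    exact hbot (le_bot_iff.1 this ▸ hd)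
  refine ⟨⟨hF.toPFilter, ?_, ?_, ?_⟩, a, haG, le_rfl⟩
  · rintro ⟨b, hb, h⟩
    exact hbot (le_bot_iff.1 h ▸ hb)
  · rintro x y ⟨b, hb, hbxy⟩
    obtain ⟨c, hc, h | h⟩ := hG (.inl x)
    · exact .inl ⟨c, hc, h⟩
    · obtain ⟨d, hd, hdb, hdc⟩ := hdir b hb c hc
      refine .inr ⟨d, hd, ?_⟩
      have h₁ : d ≤ (x ⊔ y) ⊓ xᶜ := le_inf (le_trans hdb hbxy) (le_trans hdc h)
      rw [inf_sup_right, inf_compl_self, bot_sup_eq] at h₁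
      exact h₁.trans inf_le_left
  · intro X hX m hm hXF
    obtain ⟨c, hc, h⟩ := hG (.inr (⟨X, hX⟩, m))
    rcases h hm with h | ⟨x, hx, h⟩
    · exact ⟨c, hc, h⟩
    · obtain ⟨b, hb, hbx⟩ := hXF x hx
      exact (incompat hb hc hbx h).elim

end RasiowaSikorski

/-! ### Membership in Q-filters and separation -/

namespace QFilter

variable {A : Type u} [BooleanAlgebra A] {S : Set (Set A)} (F : QFilter S)

theorem inf_mem_iff {x y : A} : x ⊓ y ∈ F.filter ↔ x ∈ F.filter ∧ y ∈ F.filter :=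
  Order.PFilter.inf_mem_iff

theorem top_mem : ⊤ ∈ F.filter :=
  Order.PFilter.top_mem

theorem compl_mem_iff {x : A} : xᶜ ∈ F.filter ↔ x ∉ F.filter := by
  refine ⟨fun h h' => F.bot_notMem ?_, fun h => ?_⟩
  · rw [← inf_compl_self x]
    exact F.inf_mem_iff.2 ⟨h', h⟩
  · refine (F.prime x xᶜ ?_).resolve_left h
    rw [sup_compl_eq_top]
    exact F.top_mem

theorem mem_iff_of_isGLB {X : Set A} (hX : X ∈ S) {m : A} (hm : IsGLB X m) :
    m ∈ F.filter ↔ ∀ x ∈ X, x ∈ F.filter :=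
  ⟨fun h _ hx => Order.PFilter.mem_of_le (hm.1 hx) h, F.meet_mem X hX m hm⟩

/-- The Q-filters separate the elements of a countable Boolean algebra. -/
theorem le_of_forall_mem [Countable A] (hS : S.Countable) {x y : A}
    (h : ∀ G : QFilter S, x ∈ G.filter → y ∈ G.filter) : x ≤ y := by
  by_contra hxy
  rw [← sdiff_eq_bot_iff] at hxy
  obtain ⟨G, hG⟩ := exists_mem hS hxy
  rw [sdiff_eq, G.inf_mem_iff, G.compl_mem_iff] at hG
  exact hG.2 (h G hG.1)

end QFilter

/-! ## The Lindenbaum algebra -/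

namespace PredicateModalLogic

variable {V : Type u} {Pred : ℕ → Type u} [Infinite V] (L : PredicateModalLogic V Pred)

variable {L} in
theorem imp_trans {φ ψ χ : Formula V Pred} (h₁ : imp φ ψ ∈ L.carrier)
    (h₂ : imp ψ χ ∈ L.carrier) : imp φ χ ∈ L.carrier :=
  le_trans (a := L.cls φ) (b := L.cls ψ) (c := L.cls χ) h₁ h₂

theorem cls_and (φ ψ : Formula V Pred) : L.cls (and φ ψ) = L.cls φ ⊓ L.cls ψ := rfl

theorem cls_neg (φ : Formula V Pred) : L.cls (neg φ) = (L.cls φ)ᶜ := rfl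

theorem cls_box (φ : Formula V Pred) : L.cls (box φ) = ModalAlgebra.box (L.cls φ) := rfl

theorem cls_eq_top {φ : Formula V Pred} : L.cls φ = ⊤ ↔ φ ∈ L.carrier := by
  rw [eq_top_iff]
  change imp top φ ∈ L.carrier ↔ _
  refine ⟨fun h => L.mp _ _ (mem_of_taut fun _ ht _ _ _ => ht) h, fun h => mem_of_taut₁ h ?_⟩
  intro v _ _ ha hn
  simp only [imp, ha, hn]
  tauto

instance [Countable V] [∀ n, Countable (Pred n)] : Countable L.Lindenbaum :=
  inferInstanceAs (Countable (Quotient L.setoid))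

variable {L} in
theorem imp_all {x : V} {φ ψ : Formula V Pred} (hx : x ∉ freeVars φ)
    (h : imp φ ψ ∈ L.carrier) : imp φ (all x ψ) ∈ L.carrier :=
  L.mp _ _ (L.gen x _ h) (L.classical _ (.allImp x φ ψ hx))

theorem all_imp_inst (x y : V) (φ : Formula V Pred) : imp (all x φ) (inst y x φ) ∈ L.carrier :=
  L.classical _ (.allElim x y φ)

theorem cls_all_mono (x : V) {φ ψ : Formula V Pred} (h : L.cls φ ≤ L.cls ψ) :
    L.cls (all x φ) ≤ L.cls (all x ψ) := by
  refine imp_all (by simp [freeVars]) (imp_trans ?_ h)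
  have e := L.all_imp_inst x x φ
  rwa [inst_self] at e

theorem cls_all_congr (x : V) {φ ψ : Formula V Pred} (h : L.cls φ = L.cls ψ) :
    L.cls (all x φ) = L.cls (all x ψ) :=
  le_antisymm (L.cls_all_mono x h.le) (L.cls_all_mono x h.ge)

open Classical in
/-- Two bound variables that capture nothing give equivalent quantified formulas, provided that
substitutions into `φ` compose up to equivalence. -/
theorem cls_all_rename_le {x w u : V} {φ : Formula V Pred} {ρ : V → V}
    (hcomp : ∀ σ τ : V → V, L.cls ((φ.rename σ).rename τ) = L.cls (φ.rename (τ ∘ σ)))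
    (hw : w ∉ (φ.freeVars.erase x).image ρ) (hu : u ∉ (φ.freeVars.erase x).image ρ) :
    L.cls (all w (φ.rename (Function.update ρ x w))) ≤
      L.cls (all u (φ.rename (Function.update ρ x u))) := by
  refine imp_all ?_ ?_
  -- The free variables of the premise are the image under `ρ` of those of `φ` other than `x`, and
  -- `hu` keeps `u` out of it.
  · simp only [freeVars, freeVars_rename]
    rwa [erase_image_update hw]
  · suffices h : L.cls (inst u w (φ.rename (Function.update ρ x w))) =
        L.cls (φ.rename (Function.update ρ x u)) from imp_trans (L.all_imp_inst w u _) h.le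
    refine (hcomp _ _).trans (congrArg L.cls (rename_congr φ fun y hy => ?_))
    by_cases hyx : y = x
    · simp [hyx]
    · have h := mt (update_eq_of_notMem_image_erase hw hy).1 hyx
      rw [Function.comp_apply, Function.update_of_ne h, Function.update_of_ne hyx,
        Function.update_of_ne hyx, id]

/-- Syntactic equality can fail, because renaming in two stages and in one stage may pick different
bound variables. The induction hypothesis is exactly what `cls_all_rename_le` requires in order to
identify the two choices modulo `L`. -/
theorem cls_rename_rename (φ : Formula V Pred) (σ τ : V → V) :
    L.cls ((φ.rename σ).rename τ) = L.cls (φ.rename (τ ∘ σ)) := by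
  classical
  induction φ generalizing σ τ with
  | top => rfl
  | bot => rfl
  | atom P x => rfl
  | and φ ψ h₁ h₂ => simp only [rename, cls_and, h₁, h₂]
  | neg φ h => simp only [rename, cls_neg, h]
  | box φ h => simp only [rename, cls_box, h]
  | all x φ ih =>
    simp only [rename, freeVars_rename]
    -- The bound variable becomes `z` after `σ`, then `w` after `τ`, whereas renaming by `τ ∘ σ`
    -- directly produces `u`.
    have hz := freshVar_notMem x ((φ.freeVars.erase x).image σ)
    set z := freshVar x ((φ.freeVars.erase x).image σ)
    rw [erase_image_update hz, Finset.image_image]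
    have hw := freshVar_notMem z ((φ.freeVars.erase x).image (τ ∘ σ))
    set w := freshVar z ((φ.freeVars.erase x).image (τ ∘ σ))
    have hu := freshVar_notMem x ((φ.freeVars.erase x).image (τ ∘ σ))
    set u := freshVar x ((φ.freeVars.erase x).image (τ ∘ σ))
    rw [L.cls_all_congr w (ih _ _),
      rename_congr φ (τ := Function.update (τ ∘ σ) x w) fun y hy => ?_]
    · exact le_antisymm (L.cls_all_rename_le ih hw hu) (L.cls_all_rename_le ih hu hw)
    · by_cases hyx : y = x
      · simp [hyx]
      · have h := mt (update_eq_of_notMem_image_erase hz hy).1 hyx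
        rw [Function.comp_apply, Function.update_of_ne h, Function.update_of_ne hyx,
          Function.update_of_ne hyx, Function.comp_apply]

/-- In the Lindenbaum algebra, `[∀x φ]` is the meet of the instances `[[y/x]φ]`. -/
theorem isGLB_cls_all (x : V) (φ : Formula V Pred) :
    IsGLB (Set.range fun y => L.cls (inst y x φ)) (L.cls (all x φ)) := by
  classical
  constructor
  · rintro _ ⟨y, rfl⟩
    exact L.all_imp_inst x y φ
  · rintro ⟨χ⟩ hχ
    -- Freshness for `χ` permits generalizing `χ ⊃ [y/x]φ` over `y`; freshness for `φ` permits
    -- renaming the bound `y` back to `x`.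
    obtain ⟨y, hy⟩ := Infinite.exists_notMem_finset (χ.freeVars ∪ φ.freeVars)
    rw [Finset.mem_union, not_or] at hy
    have h : L.cls χ ≤ L.cls (all y (inst y x φ)) := imp_all hy.1 (hχ ⟨y, rfl⟩)
    refine h.trans ((L.cls_all_rename_le (L.cls_rename_rename φ) (u := x) ?_ ?_).trans_eq ?_)
    · simp [hy.2]
    · simp
    · exact congrArg (fun ψ => L.cls (all x ψ)) (inst_self x φ)

open Classical in
/-- The instances of a renamed universal formula are the renamings of its matrix. -/
theorem cls_all_rename_mem_iff {S : Set (Set L.Lindenbaum)}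
    (hS : ∀ (x : V) (φ : Formula V Pred), (Set.range fun y => L.cls (inst y x φ)) ∈ S)
    (F : QFilter S) (x : V) (φ : Formula V Pred) (a : V → V) :
    L.cls ((all x φ).rename a) ∈ F.filter ↔
      ∀ d, L.cls (φ.rename (Function.update a x d)) ∈ F.filter := by
  have hz := freshVar_notMem x ((φ.freeVars.erase x).image a)
  simp only [rename]
  set z := freshVar x ((φ.freeVars.erase x).image a)
  -- The chosen name `z` disappears on instantiation: replacing `z` by `d` after `update a x z`
  -- agrees with `update a x d` on the free variables of `φ`.
  rw [F.mem_iff_of_isGLB (hS _ _) (L.isGLB_cls_all _ _), Set.forall_mem_range]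
  refine forall_congr' fun d => ?_
  rw [inst, L.cls_rename_rename, rename_congr φ fun y hy => ?_]
  by_cases hyx : y = x
  · simp [hyx]
  · have h := mt (update_eq_of_notMem_image_erase hz hy).1 hyx
    rw [Function.comp_apply, Function.update_of_ne h, Function.update_of_ne hyx,
      Function.update_of_ne hyx, id]

/-! ## Canonical models -/

/-- The canonical interpretation on a set of Q-filters, with the variables as domain. -/
def canonical (S : Set (Set L.Lindenbaum)) {n : ℕ} (P : Pred n) (F : QFilter S) :
    Set (Fin n → V) :=
  {x | L.cls (atom P x) ∈ F.filter}

/-- The truth lemma, for any neighborhood system on the Q-filters that treats the sets of the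
form `{G | [φ] ∈ G}` as `□` does. -/
theorem val_canonical {S : Set (Set L.Lindenbaum)}
    (hS : ∀ (x : V) (φ : Formula V Pred), (Set.range fun y => L.cls (inst y x φ)) ∈ S)
    (hne : Nonempty (QFilter S)) (nbhd : QFilter S → Set (Set (QFilter S)))
    (hbox : ∀ F x, {G : QFilter S | x ∈ G.filter} ∈ nbhd F ↔ ModalAlgebra.box x ∈ F.filter)
    (φ : Formula V Pred) (a : V → V) :
    val ⟨QFilter S, hne, nbhd⟩ (L.canonical S) φ a = {F | L.cls (φ.rename a) ∈ F.filter} := by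
  induction φ generalizing a with
  | top => exact (Set.eq_univ_of_forall fun F => F.top_mem).symm
  | bot => exact (Set.eq_empty_of_forall_notMem fun F => F.bot_notMem).symm
  | atom P x => rfl
  | and φ ψ h₁ h₂ =>
    simp only [val, h₁, h₂]
    exact Set.ext fun F => F.inf_mem_iff.symm
  | neg φ h =>
    simp only [val, h]
    exact Set.ext fun F => F.compl_mem_iff.symm
  | box φ h =>
    simp only [val, h]
    exact Set.ext fun F => hbox F _
  | all x φ h =>
    simp only [val, h]
    ext F
    rw [Set.mem_iInter]
    exact (L.cls_all_rename_mem_iff hS F x φ a).symm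

theorem meetSets_countable [Countable V] [∀ n, Countable (Pred n)]
    {R : Set (OmegaPair V Pred)} (hR : R.Countable)
    (hcount : ∀ r ∈ R, r.CountablyManyInstances) : (L.meetSets R).Countable := by
  refine Set.Countable.union ?_ ?_
  -- The hypothesis counts sets of formulas; their images under `L.cls` are the required sets of
  -- classes.
  · refine (hR.biUnion fun r hr => (hcount r hr).image (Set.image L.cls)).mono ?_
    rintro _ ⟨r, hr, s, rfl⟩
    exact Set.mem_biUnion hr ⟨_, ⟨s, rfl⟩, (Set.range_comp _ _).symm⟩
  · refine (Set.countable_range fun p : V × Formula V Pred =>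
      Set.range fun y => L.cls (inst y p.1 p.2)).mono ?_
    rintro _ ⟨x, φ, rfl⟩
    exact ⟨(x, φ), rfl⟩

theorem isSound_frameClass : L.IsSound (frameClass L.carrier) :=
  fun _ hφ _ hZ => hZ _ hφ

/-- Completeness from a frame on the Q-filters that validates the logic. -/
theorem isComplete_of_qFilter [Countable V] [∀ n, Countable (Pred n)]
    {S : Set (Set L.Lindenbaum)} (hSc : S.Countable)
    (hS : ∀ (x : V) (φ : Formula V Pred), (Set.range fun y => L.cls (inst y x φ)) ∈ S)
    (nbhd : QFilter S → Set (Set (QFilter S)))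
    (hbox : ∀ F x, {G : QFilter S | x ∈ G.filter} ∈ nbhd F ↔ ModalAlgebra.box x ∈ F.filter)
    (hvalid : ∀ hne : Nonempty (QFilter S),
      (⟨QFilter S, hne, nbhd⟩ : NeighborhoodFrame) ∈ frameClass L.carrier) :
    L.IsComplete (frameClass L.carrier) := by
  intro φ hφ
  rw [← L.cls_eq_top, eq_top_iff]
  -- The Q-filter `F` itself witnesses that the frame is nonempty; without Q-filters the claim is
  -- vacuous.
  refine QFilter.le_of_forall_mem hSc fun F _ => ?_
  have h := hφ _ (hvalid ⟨F⟩) V (L.canonical S) id F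
  rw [L.val_canonical hS ⟨F⟩ nbhd hbox, rename_id] at h
  exact h

end PredicateModalLogic

/-! ### Neighborhoods in the two Q-filter frames -/

section QFilterFrames

variable {A : Type u} [ModalAlgebra A] {S : Set (Set A)}

/-- A neighborhood may be presented by another element `y` lying in the same Q-filters; separation
gives `x = y`, hence `□x = □y`. -/
theorem mem_qFilterFrame_nbhd_iff [Countable A] (hS : S.Countable) (h : Nonempty (QFilter S))
    (F : QFilter S) (x : A) :
    {G : QFilter S | x ∈ G.filter} ∈ (qFilterFrame S h).nbhd F ↔
      ModalAlgebra.box x ∈ F.filter := by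
  refine ⟨?_, fun hx => ⟨x, hx, rfl⟩⟩
  rintro ⟨y, hy, hxy⟩
  have hxy' (G : QFilter S) : x ∈ G.filter ↔ y ∈ G.filter := Set.ext_iff.1 hxy G
  rwa [le_antisymm (QFilter.le_of_forall_mem hS fun G => (hxy' G).1)
    (QFilter.le_of_forall_mem hS fun G => (hxy' G).2)]

/-- If `□x ∈ F`, the box inclusion supplies a member of `N F` inside `{G | x ∈ G}`. If `□x ∉ F`,
then `◇xᶜ ∈ F`, and the diamond inclusion puts in every member of `N F` some `G` that omits `x`. -/
theorem IsQSystem.mem_nbhd_iff {N : QFilter S → Set (Set (QFilter S))} (hN : IsQSystem N)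
    (h : Nonempty (QFilter S)) (F : QFilter S) (x : A) :
    {G : QFilter S | x ∈ G.filter} ∈ (qFilterFrameOf N h).nbhd F ↔
      ModalAlgebra.box x ∈ F.filter := by
  constructor
  · rintro ⟨X, hX, hXx⟩
    by_contra hx
    have hdia : ModalAlgebra.dia xᶜ ∈ F.filter := by
      rw [ModalAlgebra.dia, compl_compl]
      exact F.compl_mem_iff.2 hx
    have hmem := (hN F).2 hdia
    simp only [Set.mem_iInter, Set.mem_iUnion] at hmem
    obtain ⟨G, hG, hGx⟩ := hmem X hX
    exact G.compl_mem_iff.1 hGx (hXx hG)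
  · intro hx
    have hmem := (hN F).1 hx
    simp only [Set.mem_iInter, Set.mem_iUnion] at hmem
    obtain ⟨X, hX, hXx⟩ := hmem
    -- `X` may be empty: the intersection over it is all of `A`, and the inclusion is vacuous.
    exact ⟨X, hX, fun G hG => hXx G hG⟩

end QFilterFrames

end PML

/-! ### Soundness and completeness for both Q-filter frames -/

theorem corollary5p3 {V : Type u} {Pred : ℕ → Type u} [Countable V] [Infinite V]
    [∀ n, Countable (Pred n)] (L : PredicateModalLogic V Pred)
    (R : Set (OmegaPair V Pred)) (hR : R.Countable)
    (hcount : ∀ r ∈ R, r.CountablyManyInstances) (hadm : ∀ r ∈ R, L.Admits r) :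
    ((∀ h : Nonempty (QFilter (L.meetSets R)),
        qFilterFrame (L.meetSets R) h ∈ frameClass L.carrier) →
      L.IsSound (frameClass L.carrier) ∧ L.IsComplete (frameClass L.carrier)) ∧
    (L.IsMonotonic →
      (∃ N : QFilter (L.meetSets R) → Set (Set (QFilter (L.meetSets R))), IsQSystem N ∧
        ∀ h : Nonempty (QFilter (L.meetSets R)),
          qFilterFrameOf N h ∈ frameClass L.carrier) →
      L.IsSound (frameClass L.carrier) ∧ L.IsComplete (frameClass L.carrier)) := by
  have hSc := L.meetSets_countable hR hcount
  have hS (x : V) (φ : Formula V Pred) :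
      (Set.range fun y => L.cls (Formula.inst y x φ)) ∈ L.meetSets R := .inr ⟨x, φ, rfl⟩
  refine ⟨fun hvalid => ⟨L.isSound_frameClass, ?_⟩,
    fun _ ⟨N, hN, hvalid⟩ => ⟨L.isSound_frameClass, ?_⟩⟩
  · exact L.isComplete_of_qFilter hSc hS _
      (fun F x => mem_qFilterFrame_nbhd_iff hSc ⟨F⟩ F x) hvalid
  · exact L.isComplete_of_qFilter hSc hS _ (fun F x => hN.mem_nbhd_iff ⟨F⟩ F x) hvalid
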